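/- For a finite signed Borel measure $\nu$ on $\mathbb{R}^5$ let $\operatorname{supp}\nu$ be the closed support of its total variation, and let $$R^2\nu(x)=\lim_{\tau\to0^+}\int_{|y-x|>\tau}\frac{y-x}{|y-x|^{3}}\,d\nu(y)$$ be its $2$-Riesz transform (in the sense of the principal value). Write $D_\varepsilon=\{x\in\mathbb{R}^5: 1-\varepsilon\le|x|\le1+\varepsilon\}$. A measure is called radial with $C^\infty$ density if $d\nu(x)=\rho(x)\,dx$ with $\rho\in C^\infty(\mathbb{R}^5)$ integrable and $\rho(x)$ depending only on $|x|$. 1. There is an absolute constant $a>0$ such that for every $\varepsilon>0$ there is a radial finite signed measure $\nu$ on $\mathbb{R}^5$ with $C^\infty$ density such that $\operatorname{supp}\nu\subset D_\varepsilon$, $R^2\nu(x)$ exists for every $x\in\mathbb{R}^5$, $|R^2\nu(x)|<\varepsilon$ for all $x\in\operatorname{supp}\nu$, and $|R^2\nu(x)|>a$ for all $x$ with $|x|=2$. 2. Consequently the maximum principle fails for signed measures, even for radial ones: for every constant $C\ge0$ there is a compactly supported radial finite signed measure $\nu$ on $\mathbb{R}^5$ with $C^\infty$ density, for which $R^2\nu$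 exists everywhere, such that $$\sup_{x\in\mathbb{R}^5}|R^2\nu(x)|>C\sup_{x\in\operatorname{supp}\nu}|R^2\nu(x)|.$$ 3. For a finite signed measure $\eta$ on $\mathbb{R}^5$ let $u_\eta(x)=\int\frac{d\eta(y)}{|y-x|}$. There is an absolute constant $b>0$ such that for every $\varepsilon>0$ there is a finite signed measure $\eta$ on $\mathbb{R}^5$ with (integrable) $C^\infty$ density such that $\operatorname{supp}\eta\subset D_\varepsilon$, the integral $u_\eta(x)$ converges absolutely for every $x$, $|u_\eta(x)|<\varepsilon$ for all $x\in\operatorname{supp}\eta$, and $|u_\eta((2,0,0,0,0))|>b$. 4. Consequently the analogous maximum principle fails for this potential: for every constant $C\ge0$ there is a compactly supported finite signed measure $\eta$ on $\mathbb{R}^5$ with $C^\infty$ density, for which $u_\eta$ converges absolutely everywhere, such that $\sup_{x\in\mathbb{R}^5}|u_\eta(x)|>C\sup_{x\in\operatorname{supp}\eta}|u_\eta(x)|$. -/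

import Mathlib

open MeasureTheory Filter Topology
open scoped ENNReal NNReal ContDiff

noncomputable section

/-- The support of a finite signed measure: the closed support of its total variation. -/
def signedSupport {d : ℕ} (ν : SignedMeasure (EuclideanSpace ℝ (Fin d))) :
    Set (EuclideanSpace ℝ (Fin d)) :=
  ν.variation.support

/-- `ν` has the (integrable) function `ρ` as density with respect to Lebesgue measure. -/
def HasDensity {d : ℕ} (ν : SignedMeasure (EuclideanSpace ℝ (Fin d)))
    (ρ : EuclideanSpace ℝ (Fin d) → ℝ) : Prop :=
  Integrable ρ volume ∧ ν = volume.withDensityᵥ ρ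

/-- `ν` is a signed measure with `C^∞` density. -/
def HasSmoothDensity {d : ℕ} (ν : SignedMeasure (EuclideanSpace ℝ (Fin d))) : Prop :=
  ∃ ρ : EuclideanSpace ℝ (Fin d) → ℝ, ContDiff ℝ ∞ ρ ∧ HasDensity ν ρ

/-- `ν` is a radial signed measure with `C^∞` density: `dν(x) = h(|x|) dx`. -/
def HasRadialSmoothDensity {d : ℕ} (ν : SignedMeasure (EuclideanSpace ℝ (Fin d))) : Prop :=
  ∃ ρ : EuclideanSpace ℝ (Fin d) → ℝ,
    ContDiff ℝ ∞ ρ ∧ (∃ h : ℝ → ℝ, ∀ x, ρ x = h ‖x‖) ∧ HasDensity ν ρ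

/-- The truncated `s`-Riesz transform `∫_{|y - x| > τ} (y - x) / |y - x|^(s+1) dν(y)`. -/
def truncatedRieszTransform {d : ℕ} (s : ℝ) (ν : SignedMeasure (EuclideanSpace ℝ (Fin d)))
    (x : EuclideanSpace ℝ (Fin d)) (τ : ℝ) : EuclideanSpace ℝ (Fin d) :=
  ∫ᵛ y in {y | τ < ‖y - x‖}, (‖y - x‖ ^ (s + 1))⁻¹ • (y - x) ∂<•ν

/-- The `s`-Riesz transform `R^s ν (x)`, as a principal value. It is meaningful where the limit
exists, see `RieszTransformExists`. -/
def rieszTransform {d : ℕ} (s : ℝ) (ν : SignedMeasure (EuclideanSpace ℝ (Fin d)))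
    (x : EuclideanSpace ℝ (Fin d)) : EuclideanSpace ℝ (Fin d) :=
  limUnder (𝓝[>] (0 : ℝ)) (truncatedRieszTransform s ν x)

/-- The principal value defining `R^s ν (x)` exists. The truncated kernels are required to be
integrable, so that no truncated integral takes a default value. -/
def RieszTransformExists {d : ℕ} (s : ℝ) (ν : SignedMeasure (EuclideanSpace ℝ (Fin d)))
    (x : EuclideanSpace ℝ (Fin d)) : Prop :=
  (∀ τ : ℝ, 0 < τ →
    ν.IntegrableOn (fun y => (‖y - x‖ ^ (s + 1))⁻¹ • (y - x)) {y | τ < ‖y - x‖}) ∧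
  ∃ v, Tendsto (truncatedRieszTransform s ν x) (𝓝[>] (0 : ℝ)) (𝓝 v)

/-- The potential `u_η(x) = ∫ dη(y) / |y - x|`. -/
def inversePotential {d : ℕ} (η : SignedMeasure (EuclideanSpace ℝ (Fin d)))
    (x : EuclideanSpace ℝ (Fin d)) : ℝ :=
  ∫ᵛ y, ‖y - x‖⁻¹ ∂•η

/-- The integral defining `u_η(x)` converges absolutely. -/
def InversePotentialExists {d : ℕ} (η : SignedMeasure (EuclideanSpace ℝ (Fin d)))
    (x : EuclideanSpace ℝ (Fin d)) : Prop :=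
  η.Integrable (fun y => ‖y - x‖⁻¹)

/-- The shell `D_ε = {1 - ε ≤ |x| ≤ 1 + ε}` in `ℝ^d`. -/
def shell (d : ℕ) (ε : ℝ) : Set (EuclideanSpace ℝ (Fin d)) :=
  {x | 1 - ε ≤ ‖x‖ ∧ ‖x‖ ≤ 1 + ε}

end

/-!
The kernel `(y - x) / |y - x|³` is the gradient in `x` of `1 / |y - x|`, and on `ℝ⁵` the function
`1 / |x|` is, up to the positive constant `bilapConst`, a fundamental solution of `Δ²`
(`pot_lap_lap`). Hence for `ν = Δ² u dx` the Riesz transform `R² ν` is a multiple of `∇ u`, and the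
potential of `∂₀ (Δ² u)` is a multiple of `∂₀ u`, so it suffices to find one radial `u`. The function
`-2 |x|⁻¹ + (2/3) |x|⁻³` is biharmonic away from the origin and critical on the unit sphere; extended
inside the unit ball by a constant it is `C¹`, and cutting off its gradient smoothly in the shell
`1 ≤ |x|² ≤ 1 + δ` gives a smooth gradient field `2 E(|x|²) x` which is `O(δ)` on that shell,
while `Δ² u` vanishes outside it and `|∇ u| = 3/8` on the sphere of radius `2`. The negative results
about the maximum principle follow by letting `δ` be small.

The function `u` does not have compact support, so the representation formula is proved
by uniqueness rather than by integrating by parts against `u`: the potential of `∂ᵢ Δ² u` and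
`bilapConst * ∂ᵢ u` have the same bilaplacian, both they and their Laplacians vanish at infinity, and
a harmonic function vanishing at infinity is zero (`pot_eq_of_lap_lap_eq`). Only compactly supported
functions are integrated against the kernels, after replacing `|x|⁻¹` by `(|x|² + a) ^ (-1/2)`, whose
bilaplacian `105 a² (|x|² + a) ^ (-9/2)` is an approximate identity as `a → 0`.
-/

/-! ### Signed measures with a density -/

section SignedDensity

variable {X : Type*} [MeasurableSpace X] {μ : Measure X}
  {G : Type*} [NormedAddCommGroup G] [NormedSpace ℝ G]

theorem integrable_withDensityᵥ {ρ : X → ℝ} (hρ : Integrable ρ μ) {g : X → G}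
    (hg : AEStronglyMeasurable g μ) (h : Integrable (fun x => ρ x • g x) μ) :
    (μ.withDensityᵥ ρ).Integrable g := by
  rw [VectorMeasure.Integrable, Measure.variation_withDensityᵥ hρ,
    integrable_withDensity_iff_integrable_smul₀' hρ.aestronglyMeasurable.enorm
      (by filter_upwards with x using by simp)]
  simp only [toReal_enorm]
  refine h.mono (hρ.aestronglyMeasurable.norm.smul hg) ?_
  filter_upwards with x
  simp [norm_smul]

theorem integral_withDensityᵥ [CompleteSpace G] {ρ : X → ℝ} (hρ : Integrable ρ μ) {g : X → G}
    (hg : AEStronglyMeasurable g μ) (h : Integrable (fun x => ρ x • g x) μ) :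
    (∫ᵛ x, g x ∂<•(μ.withDensityᵥ ρ)) = ∫ x, ρ x • g x ∂μ := by
  have h1 := isFiniteMeasure_withDensity_ofReal hρ.2
  have h2 := isFiniteMeasure_withDensity_ofReal hρ.neg.2
  have hm : AEMeasurable ρ μ := hρ.aestronglyMeasurable.aemeasurable
  have hm' : AEMeasurable (fun x => ENNReal.ofReal (-ρ x)) μ := hm.neg.ennreal_ofReal
  have hpos : Integrable (fun x => (ENNReal.ofReal (ρ x)).toReal • g x) μ := by
    refine h.mono (hm.ennreal_ofReal.ennreal_toReal.aestronglyMeasurable.smul hg) ?_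
    filter_upwards with x
    simp only [norm_smul, ENNReal.toReal_ofReal', Real.norm_eq_abs]
    refine mul_le_mul_of_nonneg_right ?_ (norm_nonneg _)
    rw [abs_of_nonneg (le_max_right _ _)]
    exact max_le (le_abs_self _) (abs_nonneg _)
  have hneg : Integrable (fun x => (ENNReal.ofReal (-ρ x)).toReal • g x) μ := by
    refine h.mono (hm'.ennreal_toReal.aestronglyMeasurable.smul hg) ?_
    filter_upwards with x
    simp only [norm_smul, ENNReal.toReal_ofReal', Real.norm_eq_abs]
    refine mul_le_mul_of_nonneg_right ?_ (norm_nonneg _)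
    rw [abs_of_nonneg (le_max_right _ _)]
    exact max_le (neg_le_abs _) (abs_nonneg _)
  rw [withDensityᵥ_eq_withDensity_pos_part_sub_withDensity_neg_part hρ,
    VectorMeasure.integral_sub_vectorMeasure, VectorMeasure.integral_toSignedMeasure,
    VectorMeasure.integral_toSignedMeasure,
    integral_withDensity_eq_integral_toReal_smul₀ hm.ennreal_ofReal (by simp),
    integral_withDensity_eq_integral_toReal_smul₀ hm' (by simp),
    ← integral_sub hpos hneg]
  · congr with x
    rw [← sub_smul, ENNReal.toReal_ofReal', ENNReal.toReal_ofReal']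
    congr 1
    exact max_zero_sub_eq_self _
  · rw [VectorMeasure.Integrable, Measure.variation_toSignedMeasure,
      integrable_withDensity_iff_integrable_smul₀' hm.ennreal_ofReal (by simp)]
    exact hpos
  · rw [VectorMeasure.Integrable, Measure.variation_toSignedMeasure,
      integrable_withDensity_iff_integrable_smul₀' hm' (by simp)]
    exact hneg

theorem restrict_withDensityᵥ {ρ : X → ℝ} (hρ : Integrable ρ μ) {s : Set X}
    (hs : MeasurableSet s) :
    (μ.withDensityᵥ ρ).restrict s = (μ.restrict s).withDensityᵥ ρ := by
  ext t ht
  rw [VectorMeasure.restrict_apply _ hs ht, withDensityᵥ_apply hρ (ht.inter hs),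
    withDensityᵥ_apply hρ.restrict ht, Measure.restrict_restrict ht]

end SignedDensity

theorem lsmul_real_eq_flip :
    ContinuousLinearMap.lsmul ℝ ℝ (E := ℝ) = (ContinuousLinearMap.lsmul ℝ ℝ (E := ℝ)).flip := by
  ext
  simp

theorem signedSupport_withDensityᵥ_subset {d : ℕ} {ρ : EuclideanSpace ℝ (Fin d) → ℝ}
    (hρ : Integrable ρ volume) {K : Set (EuclideanSpace ℝ (Fin d))} (hK : IsClosed K)
    (h : ∀ x ∉ K, ρ x = 0) : signedSupport (volume.withDensityᵥ ρ) ⊆ K := by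
  refine Measure.support_subset_of_isClosed hK ?_
  rw [mem_ae_iff, Measure.variation_withDensityᵥ hρ, withDensity_apply _ hK.measurableSet.compl,
    setLIntegral_congr_fun hK.measurableSet.compl (g := fun _ => 0) (fun x hx => by simp [h x hx])]
  simp

/-! ### Partial derivatives, radial functions and integration by parts -/

/-- Five-dimensional Euclidean space. -/
abbrev E5 : Type := EuclideanSpace ℝ (Fin 5)

/-- The partial derivative `∂ᵢ f`. -/
noncomputable def pd (i : Fin 5) (f : E5 → ℝ) : E5 → ℝ :=
  fun x => fderiv ℝ f x (EuclideanSpace.single i 1)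

/-- The Laplacian `∑ᵢ ∂ᵢ ∂ᵢ f` on `ℝ⁵`. -/
noncomputable def lap (f : E5 → ℝ) : E5 → ℝ := fun x => ∑ i, pd i (pd i f) x

theorem ContDiff.pd {f : E5 → ℝ} (hf : ContDiff ℝ ∞ f) (i : Fin 5) : ContDiff ℝ ∞ (pd i f) :=
  (hf.fderiv_right (m := ∞) (by simp)).clm_apply contDiff_const

theorem ContDiff.lap {f : E5 → ℝ} (hf : ContDiff ℝ ∞ f) : ContDiff ℝ ∞ (lap f) :=
  ContDiff.sum fun i _ => (hf.pd i).pd i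

theorem HasCompactSupport.pd {f : E5 → ℝ} (hf : HasCompactSupport f) (i : Fin 5) :
    HasCompactSupport (pd i f) := hf.fderiv_apply ℝ _

theorem HasCompactSupport.lap {f : E5 → ℝ} (hf : HasCompactSupport f) :
    HasCompactSupport (lap f) := by
  have h : _root_.lap f = ∑ i, _root_.pd i (_root_.pd i f) := by
    ext x
    simp [_root_.lap]
  rw [h]
  exact HasCompactSupport.finset_sum fun i _ => (hf.pd i).pd i

theorem pd_mul {f g : E5 → ℝ} {x : E5} (hf : DifferentiableAt ℝ f x)
    (hg : DifferentiableAt ℝ g x) (i : Fin 5) :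
    pd i (fun y => f y * g y) x = f x * pd i g x + pd i f x * g x := by
  simp only [pd]
  rw [fderiv_fun_mul hf hg]
  simp [mul_comm]

theorem pd_sub {f g : E5 → ℝ} (hf : Differentiable ℝ f) (hg : Differentiable ℝ g) (i : Fin 5) :
    pd i (fun y => f y - g y) = fun x => pd i f x - pd i g x := by
  ext x
  simp only [pd]
  rw [fderiv_fun_sub (hf x) (hg x)]
  simp

theorem pd_const_mul {f : E5 → ℝ} (c : ℝ) (i : Fin 5) :
    pd i (fun y => c * f y) = fun x => c * pd i f x := by
  ext x
  simp only [pd]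
  rw [show (fun y => c * f y) = c • f from rfl, fderiv_const_smul_field]
  simp

theorem lap_sub {f g : E5 → ℝ} (hf : ContDiff ℝ ∞ f) (hg : ContDiff ℝ ∞ g) :
    lap (fun y => f y - g y) = fun x => lap f x - lap g x := by
  ext x
  simp only [lap]
  rw [← Finset.sum_sub_distrib]
  refine Finset.sum_congr rfl fun i _ => ?_
  rw [pd_sub (hf.differentiable (by simp)) (hg.differentiable (by simp)),
    pd_sub ((hf.pd i).differentiable (by simp)) ((hg.pd i).differentiable (by simp))]

theorem lap_const_mul {f : E5 → ℝ} (c : ℝ) :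
    lap (fun y => c * f y) = fun x => c * lap f x := by
  ext x
  simp only [lap, pd_const_mul, Finset.mul_sum]

theorem pd_comp_add_left (f : E5 → ℝ) (a : E5) (i : Fin 5) :
    pd i (fun y => f (a + y)) = fun y => pd i f (a + y) := by
  ext x
  simp only [pd]
  rw [fderiv_comp_add_left]

theorem lap_comp_add_left (f : E5 → ℝ) (a : E5) :
    lap (fun y => f (a + y)) = fun y => lap f (a + y) := by
  ext x
  simp only [lap, pd_comp_add_left]

theorem pd_coord (i j : Fin 5) (x : E5) : pd j (fun y => y i) x = if i = j then 1 else 0 := by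
  have h : HasFDerivAt (fun y : E5 => y i) (EuclideanSpace.proj (𝕜 := ℝ) i : E5 →L[ℝ] ℝ) x :=
    (EuclideanSpace.proj (𝕜 := ℝ) i : E5 →L[ℝ] ℝ).hasFDerivAt
  simp only [pd]
  rw [h.fderiv]
  simp

theorem hasFDerivAt_radial {F : ℝ → ℝ} {F' : ℝ} {x : E5} (h : HasDerivAt F F' (‖x‖ ^ 2)) :
    HasFDerivAt (fun y : E5 => F (‖y‖ ^ 2)) (F' • ((2 : ℕ) • innerSL ℝ x)) x :=
  h.comp_hasFDerivAt x (hasStrictFDerivAt_norm_sq x).hasFDerivAt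

theorem pd_radial {F : ℝ → ℝ} {F' : ℝ} {x : E5} (h : HasDerivAt F F' (‖x‖ ^ 2)) (i : Fin 5) :
    pd i (fun y : E5 => F (‖y‖ ^ 2)) x = x i * (2 * F') := by
  simp only [pd]
  rw [(hasFDerivAt_radial h).fderiv]
  simp [EuclideanSpace.inner_single_right]
  ring

theorem norm_sq_eq_sum (x : E5) : ∑ i, x i ^ 2 = ‖x‖ ^ 2 := by
  rw [EuclideanSpace.norm_sq_eq]
  simp

theorem pd_coord_mul_radial {F : ℝ → ℝ} {F' : ℝ} {x : E5} (h : HasDerivAt F F' (‖x‖ ^ 2))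
    (i j : Fin 5) :
    pd j (fun y : E5 => y i * F (‖y‖ ^ 2)) x =
      x i * (x j * (2 * F')) + (if i = j then 1 else 0) * F (‖x‖ ^ 2) := by
  rw [pd_mul (f := fun y : E5 => y i) (by fun_prop) (hasFDerivAt_radial h).differentiableAt,
    pd_radial h, pd_coord]

theorem lap_radial {F F' F'' : ℝ → ℝ} (h : ∀ s, 0 ≤ s → HasDerivAt F (F' s) s)
    (h' : ∀ s, 0 ≤ s → HasDerivAt F' (F'' s) s) :
    lap (fun y : E5 => F (‖y‖ ^ 2)) =
      fun x => 4 * ‖x‖ ^ 2 * F'' (‖x‖ ^ 2) + 10 * F' (‖x‖ ^ 2) := by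
  ext x
  have h1 : ∀ i, pd i (fun y : E5 => F (‖y‖ ^ 2)) = fun y => y i * (2 * F' (‖y‖ ^ 2)) :=
    fun i => funext fun y => pd_radial (h _ (sq_nonneg _)) i
  simp only [lap, h1]
  have h2 : ∀ i, pd i (fun y : E5 => y i * (2 * F' (‖y‖ ^ 2))) x =
      x i ^ 2 * (4 * F'' (‖x‖ ^ 2)) + 2 * F' (‖x‖ ^ 2) := fun i => by
    rw [pd_coord_mul_radial (F := fun s => 2 * F' s) ((h' _ (sq_nonneg _)).const_mul 2)]
    simp only [if_true]
    ring
  simp only [h2, Finset.sum_add_distrib, ← Finset.sum_mul, norm_sq_eq_sum]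
  simp
  ring

theorem lap_coord_mul_radial {F F' F'' : ℝ → ℝ} (h : ∀ s, 0 ≤ s → HasDerivAt F (F' s) s)
    (h' : ∀ s, 0 ≤ s → HasDerivAt F' (F'' s) s) (i : Fin 5) :
    lap (fun y : E5 => y i * F (‖y‖ ^ 2)) =
      fun x => x i * (4 * ‖x‖ ^ 2 * F'' (‖x‖ ^ 2) + 14 * F' (‖x‖ ^ 2)) := by
  ext x
  have h1 : ∀ j, pd j (fun y : E5 => y i * F (‖y‖ ^ 2)) = fun y =>
      y i * (y j * (2 * F' (‖y‖ ^ 2))) + (if i = j then 1 else 0) * F (‖y‖ ^ 2) :=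
    fun j => funext fun y => pd_coord_mul_radial (h _ (sq_nonneg _)) i j
  simp only [lap, h1]
  have hF' := (hasFDerivAt_radial (x := x) ((h' _ (sq_nonneg _)).const_mul 2)).differentiableAt
  have hF := (hasFDerivAt_radial (x := x) (h _ (sq_nonneg _))).differentiableAt
  have h2 : ∀ j, pd j (fun y : E5 => y i * (y j * (2 * F' (‖y‖ ^ 2))) +
      (if i = j then 1 else 0) * F (‖y‖ ^ 2)) x =
      x i * (x j ^ 2 * (4 * F'' (‖x‖ ^ 2)) + 2 * F' (‖x‖ ^ 2)) +
        (if i = j then 1 else 0) * (x j * (4 * F' (‖x‖ ^ 2))) := fun j => by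
    have e1 : pd j (fun y : E5 => y i * (y j * (2 * F' (‖y‖ ^ 2)))) x =
        x i * (x j * (x j * (2 * (2 * F'' (‖x‖ ^ 2)))) + 2 * F' (‖x‖ ^ 2)) +
          (if i = j then 1 else 0) * (x j * (2 * F' (‖x‖ ^ 2))) := by
      rw [pd_mul (f := fun y : E5 => y i) (by fun_prop)
        ((by fun_prop : DifferentiableAt ℝ (fun y : E5 => y j) x).fun_mul hF'), pd_coord,
        pd_coord_mul_radial (F := fun s => 2 * F' s) ((h' _ (sq_nonneg _)).const_mul 2)]
      simp
    have e2 : pd j (fun y : E5 => (if i = j then (1 : ℝ) else 0) * F (‖y‖ ^ 2)) x =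
        (if i = j then 1 else 0) * (x j * (2 * F' (‖x‖ ^ 2))) := by
      rw [pd_const_mul]
      simp only [pd_radial (h _ (sq_nonneg ‖x‖))]
    have e3 : pd j (fun y : E5 => y i * (y j * (2 * F' (‖y‖ ^ 2))) +
        (if i = j then 1 else 0) * F (‖y‖ ^ 2)) x =
        pd j (fun y : E5 => y i * (y j * (2 * F' (‖y‖ ^ 2)))) x +
        pd j (fun y : E5 => (if i = j then (1 : ℝ) else 0) * F (‖y‖ ^ 2)) x := by
      have d1 : DifferentiableAt ℝ (fun y : E5 => y i * (y j * (2 * F' (‖y‖ ^ 2)))) x :=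
        (by fun_prop : DifferentiableAt ℝ (fun y : E5 => y i) x).fun_mul
          ((by fun_prop : DifferentiableAt ℝ (fun y : E5 => y j) x).fun_mul hF')
      simp only [pd]
      rw [fderiv_fun_add d1 (hF.const_mul _)]
      rfl
    rw [e3, e1, e2]
    ring
  simp only [h2, Finset.sum_add_distrib, ← Finset.mul_sum, ← Finset.sum_mul, norm_sq_eq_sum]
  simp
  ring

theorem integral_mul_pd {k f : E5 → ℝ} (hk : ContDiff ℝ ∞ k) (hf : ContDiff ℝ ∞ f)
    (hfc : HasCompactSupport f) (i : Fin 5) :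
    ∫ x, k x * pd i f x = -∫ x, pd i k x * f x :=
  integral_mul_fderiv_eq_neg_fderiv_mul_of_integrable
    (((hk.pd i).continuous.mul hf.continuous).integrable_of_hasCompactSupport hfc.mul_left)
    ((hk.continuous.mul (hf.pd i).continuous).integrable_of_hasCompactSupport (hfc.pd i).mul_left)
    ((hk.continuous.mul hf.continuous).integrable_of_hasCompactSupport hfc.mul_left)
    (fun x _ => (hk.differentiable (by simp)) x) (fun x _ => (hf.differentiable (by simp)) x)

theorem integral_mul_lap {k f : E5 → ℝ} (hk : ContDiff ℝ ∞ k) (hf : ContDiff ℝ ∞ f)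
    (hfc : HasCompactSupport f) : ∫ x, k x * lap f x = ∫ x, lap k x * f x := by
  simp only [lap, Finset.mul_sum, Finset.sum_mul]
  rw [integral_finsetSum, integral_finsetSum]
  · refine Finset.sum_congr rfl fun i _ => ?_
    rw [integral_mul_pd hk (hf.pd i) (hfc.pd i), integral_mul_pd (hk.pd i) hf hfc, neg_neg]
  · exact fun i _ => (((hk.pd i).pd i).continuous.mul hf.continuous).integrable_of_hasCompactSupport
      hfc.mul_left
  · exact fun i _ => (hk.continuous.mul ((hf.pd i).pd i).continuous).integrable_of_hasCompactSupport
      ((hfc.pd i).pd i).mul_left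

/-! ### The fundamental solution of the bilaplacian -/

/-- The regularised power `(|x|² + a) ^ p`. -/
noncomputable def regPow (a p : ℝ) (x : E5) : ℝ := (‖x‖ ^ 2 + a) ^ p

theorem contDiff_regPow {a : ℝ} (ha : 0 < a) (p : ℝ) : ContDiff ℝ ∞ (regPow a p) :=
  ((contDiff_norm_sq ℝ).add contDiff_const).rpow_const_of_ne fun x => by positivity

theorem hasDerivAt_add_rpow {a s : ℝ} (h : 0 < s + a) (p : ℝ) :
    HasDerivAt (fun s => (s + a) ^ p) (p * (s + a) ^ (p - 1)) s := by
  simpa using ((hasDerivAt_id s).add_const a).rpow_const (p := p) (Or.inl h.ne')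

theorem pd_regPow {a : ℝ} (ha : 0 < a) (p : ℝ) (i : Fin 5) (x : E5) :
    pd i (regPow a p) x = 2 * p * (x i * regPow a (p - 1) x) := by
  have := pd_radial (x := x) (hasDerivAt_add_rpow (a := a) (by positivity) p) i
  simp only [regPow]
  unfold regPow
  rw [this]
  ring

theorem lap_regPow {a : ℝ} (ha : 0 < a) (p : ℝ) :
    lap (regPow a p) = fun x =>
      p * (4 * p + 6) * regPow a (p - 1) x - 4 * a * p * (p - 1) * regPow a (p - 2) x := by
  have hpos : ∀ s : ℝ, 0 ≤ s → 0 < s + a := fun s hs => by linarith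
  have := lap_radial (F := fun s => (s + a) ^ p) (F' := fun s => p * (s + a) ^ (p - 1))
    (F'' := fun s => p * ((p - 1) * (s + a) ^ (p - 1 - 1)))
    (fun s hs => hasDerivAt_add_rpow (hpos s hs) p)
    (fun s hs => (hasDerivAt_add_rpow (hpos s hs) (p - 1)).const_mul p)
  unfold regPow
  rw [this]
  ext x
  have hx := hpos _ (sq_nonneg ‖x‖)
  have e : (‖x‖ ^ 2 + a) ^ (p - 1) = (‖x‖ ^ 2 + a) ^ (p - 2) * (‖x‖ ^ 2 + a) := by
    rw [← Real.rpow_add_one hx.ne']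
    ring_nf
  rw [show p - 1 - 1 = p - 2 by ring, e]
  ring

theorem lap_lap_regPow {a : ℝ} (ha : 0 < a) :
    lap (lap (regPow a (-1 / 2))) = fun x => 105 * (a ^ 2 * regPow a (-9 / 2) x) := by
  rw [lap_regPow ha, lap_sub (contDiff_const.mul (contDiff_regPow ha _))
    (contDiff_const.mul (contDiff_regPow ha _)), lap_const_mul, lap_const_mul,
    lap_regPow ha, lap_regPow ha]
  ext x
  norm_num
  ring

theorem ae_ne_zero_E5 : ∀ᵐ t : E5, t ≠ 0 := compl_mem_ae_iff.2 (measure_singleton 0)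

theorem tendsto_regPow (p : ℝ) {t : E5} (ht : t ≠ 0) :
    Tendsto (fun a => regPow a p t) (𝓝[>] 0) (𝓝 (‖t‖ ^ (2 * p))) := by
  have h : Tendsto (fun a : ℝ => (‖t‖ ^ 2 + a) ^ p) (𝓝 0) (𝓝 ((‖t‖ ^ 2 + 0) ^ p)) :=
    (continuous_const.add continuous_id).continuousAt.tendsto.rpow_const
      (Or.inl (by simpa using ht))
  rw [add_zero, ← Real.rpow_natCast, ← Real.rpow_mul (norm_nonneg _)] at h
  exact_mod_cast h.mono_left nhdsWithin_le_nhds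

theorem regPow_le {a p : ℝ} (ha : 0 < a) (hp : p ≤ 0) {t : E5} (ht : t ≠ 0) :
    regPow a p t ≤ ‖t‖ ^ (2 * p) := by
  rw [Real.rpow_mul (norm_nonneg _)]
  have : 0 < ‖t‖ := norm_pos_iff.2 ht
  exact Real.rpow_le_rpow_of_nonpos (by positivity) (by simp [ha.le]) hp

theorem locallyIntegrable_norm_rpow {q : ℝ} (hq : -5 < q) :
    LocallyIntegrable (fun t : E5 => ‖t‖ ^ q) := by
  refine locallyIntegrable_of_norm_le_rpow (C := 1) (α := -q) (by simp) (by simp; linarith) ?_ ?_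
  · filter_upwards with t
    rw [neg_neg, one_mul, Real.norm_of_nonneg (by positivity)]
  · exact (measurable_norm.pow_const q).aestronglyMeasurable

theorem integrable_norm_rpow_mul {q : ℝ} (hq : -5 < q) {f : E5 → ℝ} (hf : Continuous f)
    (hfc : HasCompactSupport f) : Integrable (fun t : E5 => ‖t‖ ^ q * f t) := by
  have := (locallyIntegrable_norm_rpow hq).integrable_smul_left_of_hasCompactSupport hf hfc
  simpa [mul_comm] using this

/-- The regularisation can be removed under the integral sign when the limit kernel
`m(t) |t| ^ (2p)` has an integrable singularity. -/
theorem tendsto_integral_regPow_mul {m : E5 → ℝ} {p q : ℝ} (hm : Continuous m) (hp : p ≤ 0)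
    (hq : -5 < q) (hmq : ∀ t : E5, t ≠ 0 → |m t| * ‖t‖ ^ (2 * p) ≤ ‖t‖ ^ q)
    {f : E5 → ℝ} (hf : Continuous f) (hfc : HasCompactSupport f) :
    Tendsto (fun a => ∫ t, m t * regPow a p t * f t) (𝓝[>] 0)
      (𝓝 (∫ t, m t * ‖t‖ ^ (2 * p) * f t)) := by
  refine tendsto_integral_filter_of_dominated_convergence (fun t => ‖t‖ ^ q * |f t|) ?_ ?_ ?_ ?_
  · filter_upwards [self_mem_nhdsWithin] with a ha
    exact ((hm.mul (contDiff_regPow ha p).continuous).mul hf).aestronglyMeasurable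
  · filter_upwards [self_mem_nhdsWithin] with a ha
    filter_upwards [ae_ne_zero_E5] with t ht
    rw [norm_mul, norm_mul, Real.norm_eq_abs, Real.norm_eq_abs, Real.norm_eq_abs]
    refine mul_le_mul_of_nonneg_right (le_trans ?_ (hmq t ht)) (abs_nonneg _)
    have h0 : 0 ≤ regPow a p t := Real.rpow_nonneg (by have := Set.mem_Ioi.1 ha; positivity) _
    rw [abs_of_nonneg h0]
    exact mul_le_mul_of_nonneg_left (regPow_le ha hp ht) (abs_nonneg _)
  · exact integrable_norm_rpow_mul hq hf.abs hfc.norm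
  · filter_upwards [ae_ne_zero_E5] with t ht
    exact ((tendsto_regPow p ht).const_mul _).mul_const _

theorem HasCompactSupport.comp_add_left {f : E5 → ℝ} (hf : HasCompactSupport f) (x : E5) :
    HasCompactSupport fun t => f (x + t) :=
  hf.comp_homeomorph (Homeomorph.addLeft x)

/-- The normalising constant in the fundamental solution of the bilaplacian:
`Δ² |x|⁻¹ = c δ₀` on `ℝ⁵`. -/
noncomputable def bilapConst : ℝ := 105 * ∫ z : E5, regPow 1 (-9 / 2) z

theorem integrable_regPow_one : Integrable (regPow 1 (-9 / 2)) := by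
  have := integrable_rpow_neg_one_add_norm_sq (E := E5) (μ := volume) (r := 9) (by simp; norm_num)
  refine this.congr ?_
  filter_upwards with x
  simp only [regPow]
  rw [add_comm]

theorem bilapConst_pos : 0 < bilapConst := by
  have hpos : ∀ x : E5, 0 < regPow 1 (-9 / 2) x := fun x => by
    unfold regPow
    positivity
  refine mul_pos (by norm_num) ((integral_pos_iff_support_of_nonneg (fun x => (hpos x).le)
    integrable_regPow_one).2 ?_)
  rw [show Function.support (regPow 1 (-9 / 2)) = Set.univ from
    Set.eq_univ_of_forall fun x => (hpos x).ne']
  simp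

/-- The bilaplacians of the regularised kernels form an approximate identity, of mass `bilapConst`; the
regularisation parameter is `δ ^ 2` so that `t = δ z` scales the kernel to `δ = 1`. -/
theorem tendsto_integral_approx_identity {f : E5 → ℝ} (hf : Continuous f)
    (hfc : HasCompactSupport f) :
    Tendsto (fun δ : ℝ => ∫ t, 105 * ((δ ^ 2) ^ 2 * regPow (δ ^ 2) (-9 / 2) t) * f t) (𝓝[>] 0)
      (𝓝 (bilapConst * f 0)) := by
  have key : ∀ δ : ℝ, 0 < δ → ∫ t, 105 * ((δ ^ 2) ^ 2 * regPow (δ ^ 2) (-9 / 2) t) * f t =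
      105 * ∫ z, regPow 1 (-9 / 2) z * f (δ • z) := fun δ hδ => by
    have h1 := Measure.integral_comp_smul (volume : Measure E5)
      (fun t => 105 * ((δ ^ 2) ^ 2 * regPow (δ ^ 2) (-9 / 2) t) * f t) δ
    have h2 : ∀ z : E5, regPow (δ ^ 2) (-9 / 2) (δ • z) = (δ ^ 9)⁻¹ * regPow 1 (-9 / 2) z := by
      intro z
      simp only [regPow, norm_smul, mul_pow, Real.norm_eq_abs, sq_abs]
      rw [show δ ^ 2 * ‖z‖ ^ 2 + δ ^ 2 = δ ^ 2 * (‖z‖ ^ 2 + 1) by ring,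
        Real.mul_rpow (by positivity) (by positivity), ← Real.rpow_natCast δ 2,
        ← Real.rpow_mul hδ.le, ← Real.rpow_natCast δ 9, ← Real.rpow_neg hδ.le]
      norm_num
    have h3 : ∫ t, 105 * ((δ ^ 2) ^ 2 * regPow (δ ^ 2) (-9 / 2) t) * f t = δ ^ 5 *
        ∫ z, 105 * ((δ ^ 2) ^ 2 * regPow (δ ^ 2) (-9 / 2) (δ • z)) * f (δ • z) := by
      rw [h1, abs_of_pos (by positivity)]
      simp
      field_simp
    rw [h3, ← integral_const_mul, ← integral_const_mul]
    congr with z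
    rw [h2]
    field_simp
  have lim : Tendsto (fun δ : ℝ => ∫ z : E5, regPow 1 (-9 / 2) z * f (δ • z)) (𝓝[>] 0)
      (𝓝 (∫ z : E5, regPow 1 (-9 / 2) z * f 0)) := by
    obtain ⟨C, hC⟩ := hf.bounded_above_of_compact_support hfc
    refine tendsto_integral_filter_of_dominated_convergence
      (fun z => regPow 1 (-9 / 2) z * C) ?_ ?_ (integrable_regPow_one.mul_const _) ?_
    · filter_upwards with δ
      exact ((contDiff_regPow one_pos _).continuous.mul
        (hf.comp (continuous_const_smul δ))).aestronglyMeasurable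
    · filter_upwards with δ
      filter_upwards with z
      rw [norm_mul, Real.norm_of_nonneg (by unfold regPow; positivity)]
      exact mul_le_mul_of_nonneg_left (hC _) (by unfold regPow; positivity)
    · filter_upwards with z
      refine Tendsto.const_mul _ ?_
      have : Tendsto (fun δ : ℝ => f (δ • z)) (𝓝 0) (𝓝 (f ((0 : ℝ) • z))) :=
        (hf.comp (continuous_id.smul continuous_const)).tendsto 0
      rw [zero_smul] at this
      exact this.mono_left nhdsWithin_le_nhds
  rw [integral_mul_const] at lim
  rw [bilapConst, mul_assoc]
  refine (lim.const_mul 105).congr' ?_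
  filter_upwards [self_mem_nhdsWithin] with δ hδ using (key δ hδ).symm

/-- The potential `∫ f(y) / |y - x| dy`, written in the variable `t = y - x`. -/
noncomputable def pot (f : E5 → ℝ) (x : E5) : ℝ := ∫ t, ‖t‖⁻¹ * f (x + t)

/-- `|x|⁻¹ / bilapConst` is a fundamental solution of `Δ²` on `ℝ⁵`. -/
theorem pot_lap_lap {f : E5 → ℝ} (hf : ContDiff ℝ ∞ f) (hfc : HasCompactSupport f) (x : E5) :
    pot (lap (lap f)) x = bilapConst * f x := by
  have hg : ContDiff ℝ ∞ fun t => f (x + t) := hf.comp (contDiff_const.add contDiff_id)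
  have hgc := hfc.comp_add_left x
  have h1 := tendsto_integral_regPow_mul (m := fun _ => 1) (p := -1 / 2) (q := -1)
    continuous_const (by norm_num) (by norm_num) (fun t _ => by norm_num) hg.lap.lap.continuous
    hgc.lap.lap
  have hsq : Tendsto (fun δ : ℝ => δ ^ 2) (𝓝[>] 0) (𝓝[>] 0) := by
    refine tendsto_nhdsWithin_iff.2 ⟨?_, ?_⟩
    · have : Tendsto (fun δ : ℝ => δ ^ 2) (𝓝 0) (𝓝 (0 ^ 2)) := (continuous_pow 2).tendsto 0
      rw [zero_pow two_ne_zero] at this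
      exact this.mono_left nhdsWithin_le_nhds
    · filter_upwards [self_mem_nhdsWithin] with δ hδ
      have := Set.mem_Ioi.1 hδ
      exact Set.mem_Ioi.2 (by positivity)
  have h2 := tendsto_integral_approx_identity hg.continuous hgc
  have h3 := tendsto_nhds_unique (h1.comp hsq) (h2.congr' ?_)
  · simp only [add_zero] at h3
    rw [← h3, pot]
    simp only [lap_comp_add_left]
    congr with t
    rw [show (2 : ℝ) * (-1 / 2) = -1 by norm_num, Real.rpow_neg_one, one_mul]
  · filter_upwards [self_mem_nhdsWithin] with δ hδ
    have hδ2 : 0 < δ ^ 2 := pow_pos (Set.mem_Ioi.1 hδ) 2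
    simp only [Function.comp, one_mul]
    rw [integral_mul_lap (contDiff_regPow hδ2 _) hg.lap hgc.lap,
      integral_mul_lap (contDiff_regPow hδ2 _).lap hg hgc, lap_lap_regPow hδ2]

/-- Integration by parts across the singularity: `∂ᵢ |t|⁻¹ = -tᵢ |t|⁻³`. -/
theorem pot_pd {f : E5 → ℝ} (hf : ContDiff ℝ ∞ f) (hfc : HasCompactSupport f) (i : Fin 5)
    (x : E5) : pot (pd i f) x = ∫ t : E5, t i * ‖t‖ ^ (-3 : ℝ) * f (x + t) := by
  have hg : ContDiff ℝ ∞ fun t => f (x + t) := hf.comp (contDiff_const.add contDiff_id)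
  have hgc := hfc.comp_add_left x
  have h1 := tendsto_integral_regPow_mul (m := fun _ => 1) (p := -1 / 2) (q := -1)
    continuous_const (by norm_num) (by norm_num) (fun t _ => by norm_num) (hg.pd i).continuous
    (hgc.pd i)
  have h2 := tendsto_integral_regPow_mul (m := fun t => t i) (p := -3 / 2) (q := -2)
    (by fun_prop) (by norm_num) (by norm_num) (fun t ht => ?_) hg.continuous hgc
  · have h3 := tendsto_nhds_unique h1 (h2.congr' ?_)
    · rw [pot]
      norm_num [Real.rpow_neg_one, pd_comp_add_left] at h3 ⊢
      exact h3
    · filter_upwards [self_mem_nhdsWithin] with a ha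
      simp only [one_mul]
      rw [integral_mul_pd (contDiff_regPow ha _) hg hgc, ← integral_neg]
      congr with t
      rw [pd_regPow ha]
      norm_num
  · have : 0 < ‖t‖ := norm_pos_iff.2 ht
    rw [show (2 : ℝ) * (-3 / 2) = -2 - 1 by norm_num, Real.rpow_sub_one this.ne']
    calc |t i| * (‖t‖ ^ (-2 : ℝ) / ‖t‖) ≤ ‖t‖ * (‖t‖ ^ (-2 : ℝ) / ‖t‖) := by
          gcongr
          exact PiLp.norm_apply_le t i
      _ = ‖t‖ ^ (-2 : ℝ) := by field_simp

/-! ### Potentials and a Liouville theorem -/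

open scoped Convolution in
theorem pot_eq_convolution (f : E5 → ℝ) :
    pot f = (fun t : E5 => ‖t‖⁻¹) ⋆[ContinuousLinearMap.mul ℝ ℝ, volume] f := by
  ext x
  rw [pot, convolution, ← integral_neg_eq_self]
  simp [sub_eq_add_neg]

theorem locallyIntegrable_norm_inv : LocallyIntegrable (fun t : E5 => ‖t‖⁻¹) := by
  simpa [Real.rpow_neg_one] using locallyIntegrable_norm_rpow (q := -1) (by norm_num)

theorem ContDiff.pot {f : E5 → ℝ} (hf : ContDiff ℝ ∞ f) (hfc : HasCompactSupport f) :
    ContDiff ℝ ∞ (pot f) := by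
  rw [pot_eq_convolution]
  exact hfc.contDiff_convolution_right _ locallyIntegrable_norm_inv hf

theorem pd_pot {f : E5 → ℝ} (hf : ContDiff ℝ ∞ f) (hfc : HasCompactSupport f) (i : Fin 5) :
    pd i (pot f) = pot (pd i f) := by
  have hf1 : ContDiff ℝ 1 f := hf.of_le (by simp)
  ext x
  rw [pd, pot_eq_convolution, pot_eq_convolution,
    (hfc.hasFDerivAt_convolution_right _ locallyIntegrable_norm_inv hf1 x).fderiv]
  exact convolution_precompR_apply _ locallyIntegrable_norm_inv (hfc.fderiv ℝ)
    (hf1.continuous_fderiv one_ne_zero) _ _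

theorem integrable_norm_inv_mul {f : E5 → ℝ} (hf : Continuous f) (hfc : HasCompactSupport f)
    (x : E5) : Integrable fun t : E5 => ‖t‖⁻¹ * f (x + t) := by
  simpa [Real.rpow_neg_one] using integrable_norm_rpow_mul (q := -1) (by norm_num)
    (hf.comp (continuous_const_add x)) (hfc.comp_add_left x)

theorem lap_pot {f : E5 → ℝ} (hf : ContDiff ℝ ∞ f) (hfc : HasCompactSupport f) :
    lap (pot f) = pot (lap f) := by
  ext x
  simp only [lap, pd_pot hf hfc, pd_pot (hf.pd _) (hfc.pd _)]
  simp only [pot, _root_.lap, Finset.mul_sum]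
  rw [integral_finsetSum]
  exact fun i _ => integrable_norm_inv_mul ((hf.pd i).pd i).continuous ((hfc.pd i).pd i) x

theorem tendsto_pot_cocompact {f : E5 → ℝ} (hf : Continuous f) (hfc : HasCompactSupport f) :
    Tendsto (pot f) (cocompact E5) (𝓝 0) := by
  obtain ⟨R, hR⟩ := hfc.isCompact.isBounded.exists_norm_le
  have hint : Integrable f := hf.integrable_of_hasCompactSupport hfc
  have hlim : Tendsto (fun x : E5 => (‖x‖ - R)⁻¹ * ∫ y, |f y|) (cocompact E5) (𝓝 0) := by
    have h1 : Tendsto (fun x : E5 => ‖x‖ - R) (cocompact E5) atTop :=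
      tendsto_atTop_add_const_right _ _ (tendsto_norm_cocompact_atTop (E := E5))
    simpa using h1.inv_tendsto_atTop.mul_const (∫ y, |f y|)
  refine squeeze_zero_norm' ?_ hlim
  filter_upwards [(tendsto_norm_cocompact_atTop (E := E5)).eventually_gt_atTop R] with x hx
  have e : pot f x = ∫ y, ‖y - x‖⁻¹ * f y := by
    rw [pot, ← integral_add_left_eq_self (fun y => ‖y - x‖⁻¹ * f y) x]
    simp
  rw [e, ← integral_const_mul]
  refine norm_integral_le_of_norm_le (hint.abs.const_mul _) ?_
  filter_upwards with y
  rw [norm_mul, Real.norm_eq_abs (f y), Real.norm_of_nonneg (by positivity)]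
  by_cases hy : f y = 0
  · simp [hy]
  have hyR : ‖y‖ ≤ R := hR y (subset_tsupport f hy)
  have h2 : ‖x‖ - R ≤ ‖y - x‖ := by
    have := norm_sub_norm_le x y
    rw [norm_sub_rev] at this
    linarith
  have h3 : 0 < ‖x‖ - R := by linarith
  gcongr

theorem deriv_along_axis {f : E5 → ℝ} (hf : Differentiable ℝ f) (z : E5) (i : Fin 5) :
    deriv (fun t : ℝ => f (z + t • EuclideanSpace.single i 1)) =
      fun t => pd i f (z + t • EuclideanSpace.single i 1) := by
  ext t
  have h1 : HasDerivAt (fun t : ℝ => z + t • (EuclideanSpace.single i 1 : E5))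
      (EuclideanSpace.single i 1) t := by
    simpa using ((hasDerivAt_id t).smul_const (EuclideanSpace.single i 1 : E5)).const_add z
  exact ((hf _).hasFDerivAt.comp_hasDerivAt t h1).deriv

theorem pd_pd_nonpos_of_isLocalMax {f : E5 → ℝ} (hf : ContDiff ℝ ∞ f) {z : E5}
    (hz : IsLocalMax f z) (i : Fin 5) : pd i (pd i f) z ≤ 0 := by
  set e : E5 := EuclideanSpace.single i 1
  set φ : ℝ → ℝ := fun t => f (z + t • e)
  have hc : Continuous fun t : ℝ => z + t • e := by fun_prop
  have hmax : IsLocalMax φ 0 := by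
    have h : Tendsto (fun t : ℝ => z + t • e) (𝓝 0) (𝓝 z) := by
      simpa using hc.tendsto 0
    have := h.eventually hz
    simpa [IsLocalMax, IsMaxFilter, φ] using this
  have hd : deriv φ = fun t => pd i f (z + t • e) :=
    deriv_along_axis (hf.differentiable (by simp)) z i
  have hdd : deriv (deriv φ) 0 = pd i (pd i f) z := by
    rw [hd, deriv_along_axis ((hf.pd i).differentiable (by simp)) z i]
    simp
  -- A positive second derivative makes the maximum a minimum too, so `φ` is locally constant.
  by_contra! hlt
  rw [← hdd] at hlt
  have hmin := isLocalMin_of_deriv_deriv_pos hlt hmax.deriv_eq_zero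
    (hf.continuous.comp hc).continuousAt
  have hconst : φ =ᶠ[𝓝 0] fun _ => φ 0 := by
    filter_upwards [hmax, hmin] with t h1 h2 using le_antisymm h1 h2
  have := hconst.deriv.deriv_eq
  simp at this
  exact hlt.ne' this

/-- Weak maximum principle: `ε |x|²` is added to make the Laplacian positive, which excludes an
interior maximum. -/
theorem nonpos_of_lap_eq_zero {f : E5 → ℝ} (hf : ContDiff ℝ ∞ f) (hl : ∀ x, lap f x = 0)
    (h0 : Tendsto f (cocompact E5) (𝓝 0)) (x₀ : E5) : f x₀ ≤ 0 := by
  by_contra! hpos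
  have hev : ∀ᶠ x in cocompact E5, f x < f x₀ / 2 := h0.eventually (gt_mem_nhds (by linarith))
  obtain ⟨R₁, hR₁⟩ : ∃ R₁ : ℝ, ∀ x : E5, R₁ < ‖x‖ → f x < f x₀ / 2 := by
    obtain ⟨K, hK, hKs⟩ := mem_cocompact.1 hev
    obtain ⟨R, hR⟩ := hK.isBounded.exists_norm_le
    exact ⟨R, fun x hx => hKs fun hxK => absurd (hR x hxK) (not_le.2 hx)⟩
  set R := max R₁ ‖x₀‖ + 1
  have hR : ∀ x : E5, ‖x‖ = R → f x < f x₀ / 2 := fun x hx => hR₁ x (by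
    have := le_max_left R₁ ‖x₀‖
    linarith)
  have hx₀ : ‖x₀‖ ≤ R := by
    have := le_max_right R₁ ‖x₀‖
    linarith
  have hRpos : 0 < R := by
    have := (norm_nonneg x₀).trans (le_max_right R₁ ‖x₀‖)
    linarith
  -- With this `ε` the perturbation is at most `f x₀ / 2` on the ball of radius `R`.
  set ε := f x₀ / (2 * R ^ 2)
  have hε : 0 < ε := by positivity
  have hεR : ε * R ^ 2 = f x₀ / 2 := by
    simp only [ε]
    field_simp
  set g : E5 → ℝ := fun x => f x - -ε * ‖x‖ ^ 2
  have hq : ContDiff ℝ ∞ fun x : E5 => -ε * ‖x‖ ^ 2 := contDiff_const.mul (contDiff_norm_sq ℝ)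
  have hg : ContDiff ℝ ∞ g := hf.sub hq
  obtain ⟨z, hz, hzmax⟩ := (isCompact_closedBall (0 : E5) R).exists_isMaxOn
    ⟨x₀, by simpa using hx₀⟩ hg.continuous.continuousOn
  have hzR : ‖z‖ < R := by
    refine lt_of_le_of_ne (by simpa using hz) fun h => ?_
    have h1 : g x₀ ≤ g z := hzmax (by simpa using hx₀)
    have h2 := hR z h
    have h3 : 0 ≤ ε * ‖x₀‖ ^ 2 := by positivity
    simp only [g, h] at h1
    linarith
  have hloc : IsLocalMax g z := hzmax.isLocalMax
    (Filter.mem_of_superset (Metric.isOpen_ball.mem_nhds (by simpa using hzR))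
      Metric.ball_subset_closedBall)
  have hlap : lap g z = 10 * ε := by
    have h1 := lap_radial (F := fun s => -ε * s) (F' := fun _ => -ε) (F'' := fun _ => 0)
      (fun s _ => by simpa using (hasDerivAt_id s).const_mul (-ε))
      (fun s _ => hasDerivAt_const s _)
    rw [lap_sub hf hq, h1]
    simp only [hl]
    ring
  have hle : lap g z ≤ 0 :=
    Finset.sum_nonpos fun i _ => pd_pd_nonpos_of_isLocalMax hg hloc i
  linarith

/-- Liouville's theorem for harmonic functions vanishing at infinity. -/
theorem eq_zero_of_lap_eq_zero {f : E5 → ℝ} (hf : ContDiff ℝ ∞ f) (hl : ∀ x, lap f x = 0)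
    (h0 : Tendsto f (cocompact E5) (𝓝 0)) (x : E5) : f x = 0 := by
  refine le_antisymm (nonpos_of_lap_eq_zero hf hl h0 x) ?_
  have h := nonpos_of_lap_eq_zero (f := fun y => -1 * f y) (contDiff_const.mul hf)
    (fun y => by simp only [lap_const_mul, hl, mul_zero]) (by simpa using h0.neg) x
  linarith

/-- A smooth `g` with `Δ² g = f` compactly supported is, up to the constant, the potential of `f`
as soon as `g` and `Δ g` vanish at infinity: both Laplacians of the difference are removed by
Liouville's theorem. -/
theorem pot_eq_of_lap_lap_eq {f g : E5 → ℝ} (hf : ContDiff ℝ ∞ f) (hfc : HasCompactSupport f)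
    (hg : ContDiff ℝ ∞ g) (hgf : lap (lap g) = f) (h0 : Tendsto g (cocompact E5) (𝓝 0))
    (h1 : Tendsto (lap g) (cocompact E5) (𝓝 0)) (x : E5) : pot f x = bilapConst * g x := by
  set D : E5 → ℝ := fun y => pot f y - bilapConst * g y
  have hp := hf.pot hfc
  have hcg : ContDiff ℝ ∞ fun y => bilapConst * g y := contDiff_const.mul hg
  have hD : ContDiff ℝ ∞ D := hp.sub hcg
  have hlD : lap D = fun y => pot (lap f) y - bilapConst * lap g y := by
    rw [lap_sub hp hcg, lap_const_mul, lap_pot hf hfc]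
  have hllD : ∀ y, lap (lap D) y = 0 := fun y => by
    rw [hlD, lap_sub (hf.lap.pot hfc.lap) (contDiff_const.mul hg.lap), lap_const_mul,
      lap_pot hf.lap hfc.lap, hgf]
    simp only [pot_lap_lap hf hfc, sub_self]
  have hzero : ∀ y, lap D y = 0 := eq_zero_of_lap_eq_zero hD.lap hllD (by
    rw [hlD]
    simpa using (tendsto_pot_cocompact hf.lap.continuous hfc.lap).sub (h1.const_mul bilapConst))
  have := eq_zero_of_lap_eq_zero hD hzero (by
    simpa using (tendsto_pot_cocompact hf.continuous hfc).sub (h0.const_mul bilapConst)) x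
  exact sub_eq_zero.1 this

/-! ### The radial density -/

/-- The profile of the gradient field `2 E(|x|²) x`: it vanishes for `s ≤ 1` and equals
`s ^ (-3/2) - s ^ (-5/2)` for `s ≥ 1 + δ`, where the field is the gradient of the biharmonic function
`-2 |x|⁻¹ + (2/3) |x|⁻³`, which is critical on the unit sphere. -/
noncomputable def profile (δ s : ℝ) : ℝ :=
  Real.smoothTransition ((s - 1) / δ) * ((s - 1) * s ^ (-5 / 2 : ℝ))

theorem profile_of_le_one {δ s : ℝ} (hδ : 0 < δ) (hs : s ≤ 1) : profile δ s = 0 := by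
  rw [profile, Real.smoothTransition.zero_of_nonpos, zero_mul]
  exact div_nonpos_of_nonpos_of_nonneg (by linarith) hδ.le

theorem profile_of_ge {δ s : ℝ} (hδ : 0 < δ) (hs : 1 + δ ≤ s) :
    profile δ s = s ^ (-3 / 2 : ℝ) - s ^ (-5 / 2 : ℝ) := by
  have : s ≠ 0 := by linarith
  rw [profile, Real.smoothTransition.one_of_one_le ((one_le_div hδ).2 (by linarith)), one_mul,
    show (-3 / 2 : ℝ) = -5 / 2 + 1 by norm_num, Real.rpow_add_one this]
  ring

theorem contDiff_profile {δ : ℝ} (hδ : 0 < δ) : ContDiff ℝ ∞ (profile δ) := by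
  rw [contDiff_iff_contDiffAt]
  intro s
  rcases lt_or_ge s 1 with hs | hs
  · refine (contDiffAt_const (c := (0 : ℝ))).congr_of_eventuallyEq ?_
    filter_upwards [Iio_mem_nhds hs] with t ht using profile_of_le_one hδ (le_of_lt ht)
  · have h1 : ContDiffAt ℝ ∞ (fun s : ℝ => s ^ (-5 / 2 : ℝ)) s :=
      Real.contDiffAt_rpow_const_of_ne (by linarith)
    have h2 : ContDiff ℝ ∞ fun s : ℝ => Real.smoothTransition ((s - 1) / δ) :=
      Real.smoothTransition.contDiff.comp ((contDiff_id.sub contDiff_const).div_const δ)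
    exact h2.contDiffAt.mul ((contDiffAt_id.sub contDiffAt_const).mul h1)

theorem abs_profile_le {δ s : ℝ} (hs : 1 ≤ s) (hs' : s ≤ 1 + δ) : |profile δ s| ≤ δ := by
  have h1 : s ^ (-5 / 2 : ℝ) ≤ 1 := Real.rpow_le_one_of_one_le_of_nonpos hs (by norm_num)
  have h2 : 0 ≤ s ^ (-5 / 2 : ℝ) := Real.rpow_nonneg (by linarith) _
  have h3 := Real.smoothTransition.nonneg ((s - 1) / δ)
  have h4 := Real.smoothTransition.le_one ((s - 1) / δ)
  rw [profile, abs_of_nonneg (mul_nonneg h3 (mul_nonneg (by linarith) h2))]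
  calc _ ≤ 1 * ((s - 1) * 1) := by gcongr
    _ ≤ δ := by linarith

theorem profile_four {δ : ℝ} (hδ : 0 < δ) (hδ1 : δ ≤ 1) : profile δ 4 = 3 / 32 := by
  rw [profile_of_ge hδ (by linarith), show (4 : ℝ) = 2 ^ (2 : ℝ) by norm_num,
    ← Real.rpow_mul (by norm_num), ← Real.rpow_mul (by norm_num)]
  norm_num

/-- The Laplacian of `xᵢ F(|x|²)` is `xᵢ (lapCoord F)(|x|²)`. -/
noncomputable def lapCoord (F : ℝ → ℝ) (s : ℝ) : ℝ := 4 * s * deriv (deriv F) s + 14 * deriv F s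

/-- The divergence of `2 F(|x|²) x` is `(divRadial F)(|x|²)`. -/
noncomputable def divRadial (F : ℝ → ℝ) (s : ℝ) : ℝ := 4 * s * deriv F s + 10 * F s

theorem ContDiff.deriv_infty {F : ℝ → ℝ} (hF : ContDiff ℝ ∞ F) : ContDiff ℝ ∞ (deriv F) :=
  (contDiff_infty_iff_deriv.1 hF).2

theorem ContDiff.lapCoord {F : ℝ → ℝ} (hF : ContDiff ℝ ∞ F) : ContDiff ℝ ∞ (lapCoord F) :=
  ((contDiff_const.mul contDiff_id).mul hF.deriv_infty.deriv_infty).add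
    (contDiff_const.mul hF.deriv_infty)

theorem ContDiff.divRadial {F : ℝ → ℝ} (hF : ContDiff ℝ ∞ F) : ContDiff ℝ ∞ (divRadial F) :=
  ((contDiff_const.mul contDiff_id).mul hF.deriv_infty).add (contDiff_const.mul hF)

theorem ContDiff.hasDerivAt {F : ℝ → ℝ} (hF : ContDiff ℝ ∞ F) (s : ℝ) :
    HasDerivAt F (deriv F s) s := (hF.differentiable (by simp) s).hasDerivAt

theorem lap_coord_mul {F : ℝ → ℝ} (hF : ContDiff ℝ ∞ F) (i : Fin 5) :
    lap (fun y : E5 => y i * F (‖y‖ ^ 2)) = fun x => x i * lapCoord F (‖x‖ ^ 2) :=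
  lap_coord_mul_radial (fun s _ => hF.hasDerivAt s) (fun s _ => hF.deriv_infty.hasDerivAt s) i

/-- `∂ᵢ` of the divergence of `2 F(|x|²) x` is the Laplacian of its `i`-th component, as the field is a
gradient. -/
theorem deriv_divRadial {F : ℝ → ℝ} (hF : ContDiff ℝ ∞ F) : deriv (divRadial F) = lapCoord F := by
  ext s
  have := ((((hasDerivAt_id s).const_mul 4).mul (hF.deriv_infty.hasDerivAt s)).add
    ((hF.hasDerivAt s).const_mul 10)).deriv
  rw [show divRadial F = (fun y => 4 * id y) * deriv F + fun y => 10 * F y from rfl, this, lapCoord]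
  simp
  ring

theorem lapCoord_const_mul (c : ℝ) (F : ℝ → ℝ) :
    lapCoord (fun s => c * F s) = fun s => c * lapCoord F s := by
  ext s
  simp only [lapCoord, deriv_const_mul_field', deriv_const_mul_field]
  ring

theorem lapCoord_congr {F G : ℝ → ℝ} {s : ℝ} (h : F =ᶠ[𝓝 s] G) :
    lapCoord F =ᶠ[𝓝 s] lapCoord G := by
  filter_upwards [h.deriv, h.deriv.deriv] with t h1 h2
  rw [lapCoord, lapCoord, h1, h2]

theorem divRadial_congr {F G : ℝ → ℝ} {s : ℝ} (h : F =ᶠ[𝓝 s] G) :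
    divRadial F s = divRadial G s := by
  rw [divRadial, divRadial, h.eq_of_nhds, h.deriv_eq]

theorem deriv_rpow_sub {s : ℝ} (hs : 0 < s) :
    deriv (fun t : ℝ => t ^ (-3 / 2 : ℝ) - t ^ (-5 / 2 : ℝ)) s =
      -3 / 2 * s ^ (-5 / 2 : ℝ) + 5 / 2 * s ^ (-7 / 2 : ℝ) := by
  have := ((Real.hasDerivAt_rpow_const (p := -3 / 2) (Or.inl hs.ne')).sub
    (Real.hasDerivAt_rpow_const (p := -5 / 2) (Or.inl hs.ne'))).deriv
  rw [show (fun t : ℝ => t ^ (-3 / 2 : ℝ) - t ^ (-5 / 2 : ℝ)) =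
    (fun t : ℝ => t ^ (-3 / 2 : ℝ)) - fun t : ℝ => t ^ (-5 / 2 : ℝ) from rfl, this]
  norm_num

/-- The exponent `-5/2` contributes nothing, as `xᵢ |x|⁻⁵` is harmonic. -/
theorem lapCoord_rpow_sub {s : ℝ} (hs : 0 < s) :
    lapCoord (fun t : ℝ => t ^ (-3 / 2 : ℝ) - t ^ (-5 / 2 : ℝ)) s = -6 * s ^ (-5 / 2 : ℝ) := by
  have h1 : deriv (fun t : ℝ => t ^ (-3 / 2 : ℝ) - t ^ (-5 / 2 : ℝ)) =ᶠ[𝓝 s]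
      fun t => -3 / 2 * t ^ (-5 / 2 : ℝ) + 5 / 2 * t ^ (-7 / 2 : ℝ) := by
    filter_upwards [Ioi_mem_nhds hs] with t ht using deriv_rpow_sub ht
  have h2 := (((Real.hasDerivAt_rpow_const (p := -5 / 2) (Or.inl hs.ne')).const_mul (-3 / 2)).add
    ((Real.hasDerivAt_rpow_const (p := -7 / 2) (Or.inl hs.ne')).const_mul (5 / 2))).deriv
  have e1 : s ^ (-5 / 2 : ℝ) = s * s ^ (-7 / 2 : ℝ) := by
    rw [mul_comm, ← Real.rpow_add_one hs.ne']
    norm_num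
  have e2 : s ^ (-7 / 2 : ℝ) = s * s ^ (-7 / 2 - 1 : ℝ) := by
    rw [mul_comm, ← Real.rpow_add_one hs.ne']
    norm_num
  have e3 : (-5 / 2 - 1 : ℝ) = -7 / 2 := by norm_num
  rw [lapCoord, h1.deriv_eq, h1.eq_of_nhds]
  erw [h2]
  rw [e3, e1, e2]
  ring

theorem divRadial_rpow {s : ℝ} (hs : 0 < s) :
    divRadial (fun t : ℝ => -6 * t ^ (-5 / 2 : ℝ)) s = 0 := by
  have h := ((Real.hasDerivAt_rpow_const (p := -5 / 2) (Or.inl hs.ne')).const_mul (-6)).deriv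
  have e1 : s ^ (-5 / 2 : ℝ) = s * s ^ (-5 / 2 - 1 : ℝ) := by
    rw [mul_comm, ← Real.rpow_add_one hs.ne']
    norm_num
  rw [divRadial, h, e1]
  ring

/-- The radial density, as a function of `s = |x|²`: the bilaplacian of a radial potential with
gradient `2 E(|x|²) x`. -/
noncomputable def densityProfile (δ : ℝ) : ℝ → ℝ := divRadial (lapCoord (profile δ))

theorem contDiff_densityProfile {δ : ℝ} (hδ : 0 < δ) : ContDiff ℝ ∞ (densityProfile δ) :=
  (contDiff_profile hδ).lapCoord.divRadial

theorem profile_eventuallyEq {δ s : ℝ} (hδ : 0 < δ) (hs : 1 + δ < s) :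
    profile δ =ᶠ[𝓝 s] fun t => t ^ (-3 / 2 : ℝ) - t ^ (-5 / 2 : ℝ) := by
  filter_upwards [Ioi_mem_nhds hs] with t ht using profile_of_ge hδ (le_of_lt ht)

theorem lapCoord_profile_of_gt {δ s : ℝ} (hδ : 0 < δ) (hs : 1 + δ < s) :
    lapCoord (profile δ) s = -6 * s ^ (-5 / 2 : ℝ) := by
  rw [(lapCoord_congr (profile_eventuallyEq hδ hs)).eq_of_nhds, lapCoord_rpow_sub (by linarith)]

theorem densityProfile_of_lt {δ s : ℝ} (hδ : 0 < δ) (hs : s < 1) : densityProfile δ s = 0 := by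
  have h : profile δ =ᶠ[𝓝 s] fun _ => 0 := by
    filter_upwards [Iio_mem_nhds hs] with t ht using profile_of_le_one hδ (le_of_lt ht)
  rw [densityProfile, divRadial_congr (lapCoord_congr h)]
  have h0 : lapCoord (fun _ => 0) = fun _ => 0 := by
    ext t
    simp [lapCoord]
  simp [h0, divRadial]

theorem densityProfile_of_gt {δ s : ℝ} (hδ : 0 < δ) (hs : 1 + δ < s) :
    densityProfile δ s = 0 := by
  have h : lapCoord (profile δ) =ᶠ[𝓝 s] fun t => -6 * t ^ (-5 / 2 : ℝ) := by
    filter_upwards [Ioi_mem_nhds hs] with t ht using lapCoord_profile_of_gt hδ ht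
  rw [densityProfile, divRadial_congr h, divRadial_rpow (by linarith)]

/-- The radial density on `ℝ⁵`. -/
noncomputable def density (δ : ℝ) (x : E5) : ℝ := densityProfile δ (‖x‖ ^ 2)

/-- The closed shell `1 ≤ |x|² ≤ 1 + δ` that carries the density. -/
def thinShell (δ : ℝ) : Set E5 := {x | 1 ≤ ‖x‖ ^ 2 ∧ ‖x‖ ^ 2 ≤ 1 + δ}

theorem isCompact_thinShell {δ : ℝ} (hδ1 : δ ≤ 1) : IsCompact (thinShell δ) := by
  refine (isCompact_closedBall (0 : E5) 2).of_isClosed_subset ?_ fun x hx => ?_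
  · have hn : Continuous fun x : E5 => ‖x‖ ^ 2 := by fun_prop
    exact (isClosed_le continuous_const hn).inter (isClosed_le hn continuous_const)
  · rw [mem_closedBall_zero_iff]
    have := hx.2
    nlinarith [norm_nonneg x]

theorem contDiff_density {δ : ℝ} (hδ : 0 < δ) : ContDiff ℝ ∞ (density δ) :=
  (contDiff_densityProfile hδ).comp (contDiff_norm_sq ℝ)

theorem density_eq_zero {δ : ℝ} (hδ : 0 < δ) {x : E5} (hx : x ∉ thinShell δ) :
    density δ x = 0 := by
  by_cases h : 1 ≤ ‖x‖ ^ 2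
  · exact densityProfile_of_gt hδ (not_le.1 fun h' => hx ⟨h, h'⟩)
  · exact densityProfile_of_lt hδ (not_le.1 h)

theorem hasCompactSupport_density {δ : ℝ} (hδ : 0 < δ) (hδ1 : δ ≤ 1) :
    HasCompactSupport (density δ) :=
  HasCompactSupport.intro (isCompact_thinShell hδ1) fun _ hx => density_eq_zero hδ hx

theorem pd_density_eq_zero {δ : ℝ} (hδ : 0 < δ) (hδ1 : δ ≤ 1) (i : Fin 5) {x : E5}
    (hx : x ∉ thinShell δ) : pd i (density δ) x = 0 := by
  have h : density δ =ᶠ[𝓝 x] fun _ => 0 := by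
    filter_upwards [(isCompact_thinShell hδ1).isClosed.isOpen_compl.mem_nhds hx] with y hy
    exact density_eq_zero hδ hy
  rw [pd, h.fderiv_eq]
  simp

theorem tendsto_coord_mul {F : ℝ → ℝ} {C S : ℝ} (h : ∀ s, S < s → |F s| ≤ C * s⁻¹) (i : Fin 5) :
    Tendsto (fun x : E5 => x i * F (‖x‖ ^ 2)) (cocompact E5) (𝓝 0) := by
  have hn := tendsto_norm_cocompact_atTop (E := E5)
  have hlim : Tendsto (fun x : E5 => C * ‖x‖⁻¹) (cocompact E5) (𝓝 0) := by
    simpa using hn.inv_tendsto_atTop.const_mul C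
  refine squeeze_zero_norm' ?_ hlim
  filter_upwards [hn.eventually_gt_atTop 0,
    ((tendsto_pow_atTop two_ne_zero).comp hn).eventually_gt_atTop S] with x hx hxS
  rw [norm_mul]
  calc ‖x i‖ * ‖F (‖x‖ ^ 2)‖ ≤ ‖x‖ * (C * (‖x‖ ^ 2)⁻¹) := by
        gcongr
        · exact PiLp.norm_apply_le x i
        · exact h _ hxS
    _ = C * ‖x‖⁻¹ := by field_simp

theorem rpow_le_inv {s p : ℝ} (hs : 1 ≤ s) (hp : p ≤ -1) : s ^ p ≤ s⁻¹ := by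
  rw [← Real.rpow_neg_one]
  exact Real.rpow_le_rpow_of_exponent_le hs hp

/-- The potential of `∂ᵢ ρ` is a multiple of the `i`-th component of the field `2 E(|x|²) x`. -/
theorem pot_pd_density {δ : ℝ} (hδ : 0 < δ) (hδ1 : δ ≤ 1) (i : Fin 5) (x : E5) :
    pot (pd i (density δ)) x = bilapConst * (x i * (2 * profile δ (‖x‖ ^ 2))) := by
  have hP := contDiff_profile hδ
  have h2P : ContDiff ℝ ∞ fun s => 2 * profile δ s := contDiff_const.mul hP
  have hlap := lap_coord_mul h2P i
  rw [lapCoord_const_mul] at hlap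
  refine pot_eq_of_lap_lap_eq ((contDiff_density hδ).pd i)
    ((hasCompactSupport_density hδ hδ1).pd i) (g := fun x => x i * (2 * profile δ (‖x‖ ^ 2)))
    ((by fun_prop : ContDiff ℝ ∞ fun x : E5 => x i).mul (h2P.comp (contDiff_norm_sq ℝ))) ?_ ?_ ?_ x
  · rw [hlap, lap_coord_mul (contDiff_const.mul hP.lapCoord) i, lapCoord_const_mul]
    ext y
    have hd := (contDiff_densityProfile hδ).hasDerivAt (‖y‖ ^ 2)
    rw [show density δ = fun y => densityProfile δ (‖y‖ ^ 2) from rfl, pd_radial hd,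
      densityProfile, deriv_divRadial hP.lapCoord]
  · refine tendsto_coord_mul (F := fun s => 2 * profile δ s) (C := 2) (S := 1 + δ)
      (fun s hs => ?_) i
    have hs1 : 1 ≤ s := by linarith
    have h1 := rpow_le_inv hs1 (p := -3 / 2) (by norm_num)
    have h2 : s ^ (-5 / 2 : ℝ) ≤ s ^ (-3 / 2 : ℝ) :=
      Real.rpow_le_rpow_of_exponent_le hs1 (by norm_num)
    have h3 : 0 ≤ s ^ (-5 / 2 : ℝ) := Real.rpow_nonneg (by linarith) _
    rw [profile_of_ge hδ hs.le, abs_of_nonneg (by linarith)]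
    linarith
  · rw [hlap]
    refine tendsto_coord_mul (F := fun s => 2 * lapCoord (profile δ) s) (C := 12) (S := 1 + δ)
      (fun s hs => ?_) i
    have hs1 : 1 ≤ s := by linarith
    have h1 := rpow_le_inv hs1 (p := -5 / 2) (by norm_num)
    have h3 : 0 ≤ s ^ (-5 / 2 : ℝ) := Real.rpow_nonneg (by linarith) _
    rw [lapCoord_profile_of_gt hδ hs, abs_of_nonpos (by linarith)]
    linarith

/-! ### The counterexample measures -/

/-- The kernel `(y - x) / |y - x|³` of the `2`-Riesz transform. -/
noncomputable def rieszKernel (x y : E5) : E5 := (‖y - x‖ ^ ((2 : ℝ) + 1))⁻¹ • (y - x)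

theorem measurable_rieszKernel (x : E5) : Measurable (rieszKernel x) := by
  unfold rieszKernel
  fun_prop

theorem norm_rieszKernel (x y : E5) : ‖rieszKernel x y‖ = ‖y - x‖ ^ (-2 : ℝ) := by
  rw [rieszKernel, norm_smul, norm_inv, Real.norm_of_nonneg (by positivity)]
  rcases eq_or_ne (y - x) 0 with h | h
  · simp [h]
  · have : 0 < ‖y - x‖ := norm_pos_iff.2 h
    rw [← Real.rpow_neg this.le, ← Real.rpow_add_one this.ne']
    norm_num

theorem integrable_smul_rieszKernel {ρ : E5 → ℝ} (hρ : Continuous ρ) (hc : HasCompactSupport ρ)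
    (x : E5) : Integrable fun y => ρ y • rieszKernel x y := by
  have h := (integrable_norm_rpow_mul (q := -2) (by norm_num) (hρ.comp (continuous_const_add x))
    (hc.comp_add_left x)).comp_sub_right x
  refine h.mono (hρ.aestronglyMeasurable.smul (measurable_rieszKernel x).aestronglyMeasurable) ?_
  filter_upwards with y
  simp [norm_smul, norm_rieszKernel, mul_comm]

theorem tendsto_truncatedRieszTransform {ρ : E5 → ℝ} (hρ : Continuous ρ)
    (hc : HasCompactSupport ρ) (x : E5) :
    Tendsto (truncatedRieszTransform 2 (volume.withDensityᵥ ρ) x) (𝓝[>] 0)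
      (𝓝 (∫ y, ρ y • rieszKernel x y)) := by
  have hint := hρ.integrable_of_hasCompactSupport (μ := volume) hc
  have hk := integrable_smul_rieszKernel hρ hc x
  have hS : ∀ τ : ℝ, MeasurableSet {y : E5 | τ < ‖y - x‖} := fun τ =>
    measurableSet_lt measurable_const (by fun_prop)
  have e : ∀ τ, truncatedRieszTransform 2 (volume.withDensityᵥ ρ) x τ =
      ∫ y, {y : E5 | τ < ‖y - x‖}.indicator (fun y => ρ y • rieszKernel x y) y := fun τ => by
    rw [integral_indicator (hS τ), truncatedRieszTransform, restrict_withDensityᵥ hint (hS τ)]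
    exact integral_withDensityᵥ hint.restrict (measurable_rieszKernel x).aestronglyMeasurable
      hk.restrict
  simp only [funext e]
  refine tendsto_integral_filter_of_dominated_convergence (fun y => ‖ρ y • rieszKernel x y‖)
    ?_ ?_ hk.norm ?_
  · exact Eventually.of_forall fun τ => hk.aestronglyMeasurable.indicator (hS τ)
  · exact Eventually.of_forall fun τ => Eventually.of_forall fun y => norm_indicator_le_norm_self _ _
  · filter_upwards [compl_mem_ae_iff.2 (measure_singleton x)] with y hy
    have hpos : 0 < ‖y - x‖ := norm_pos_iff.2 (sub_ne_zero.2 hy)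
    refine tendsto_const_nhds.congr' ?_
    filter_upwards [mem_nhdsWithin_of_mem_nhds (Iio_mem_nhds hpos)] with τ hτ
    exact (Set.indicator_of_mem (s := {y : E5 | τ < ‖y - x‖}) hτ
      fun y => ρ y • rieszKernel x y).symm

theorem rieszTransformExists_withDensityᵥ {ρ : E5 → ℝ} (hρ : Continuous ρ)
    (hc : HasCompactSupport ρ) (x : E5) : RieszTransformExists 2 (volume.withDensityᵥ ρ) x := by
  refine ⟨fun τ _ => ?_, _, tendsto_truncatedRieszTransform hρ hc x⟩
  exact (integrable_withDensityᵥ (hρ.integrable_of_hasCompactSupport hc)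
    (measurable_rieszKernel x).aestronglyMeasurable (integrable_smul_rieszKernel hρ hc x)).restrict

theorem rieszTransform_withDensityᵥ_apply {ρ : E5 → ℝ} (hρ : ContDiff ℝ ∞ ρ)
    (hc : HasCompactSupport ρ) (x : E5) (i : Fin 5) :
    rieszTransform 2 (volume.withDensityᵥ ρ) x i = pot (pd i ρ) x := by
  have hk := integrable_smul_rieszKernel hρ.continuous hc x
  rw [rieszTransform, (tendsto_truncatedRieszTransform hρ.continuous hc x).limUnder_eq,
    pot_pd hρ hc]
  have h := (EuclideanSpace.proj (𝕜 := ℝ) i : E5 →L[ℝ] ℝ).integral_comp_comm hk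
  refine h.symm.trans ?_
  rw [← integral_add_left_eq_self _ x]
  congr with t
  simp only [PiLp.proj_apply, rieszKernel, add_sub_cancel_left, PiLp.smul_apply, smul_eq_mul]
  rw [show (-3 : ℝ) = -(2 + 1) by norm_num, Real.rpow_neg (norm_nonneg _)]
  ring

theorem integrable_smul_norm_inv {f : E5 → ℝ} (hf : Continuous f)
    (hc : HasCompactSupport f) (x : E5) : Integrable fun y => f y • ‖y - x‖⁻¹ := by
  simpa [mul_comm] using (integrable_norm_inv_mul hf hc x).comp_sub_right x

theorem inversePotentialExists_withDensityᵥ {f : E5 → ℝ} (hf : Continuous f)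
    (hc : HasCompactSupport f) (x : E5) : InversePotentialExists (volume.withDensityᵥ f) x :=
  integrable_withDensityᵥ (hf.integrable_of_hasCompactSupport hc)
    (by fun_prop : Measurable fun y : E5 => ‖y - x‖⁻¹).aestronglyMeasurable
    (integrable_smul_norm_inv hf hc x)

theorem inversePotential_withDensityᵥ {f : E5 → ℝ} (hf : Continuous f)
    (hc : HasCompactSupport f) (x : E5) :
    inversePotential (volume.withDensityᵥ f) x = pot f x := by
  rw [inversePotential, lsmul_real_eq_flip,
    integral_withDensityᵥ (hf.integrable_of_hasCompactSupport hc)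
      (by fun_prop : Measurable fun y : E5 => ‖y - x‖⁻¹).aestronglyMeasurable
      (integrable_smul_norm_inv hf hc x), pot, ← integral_add_left_eq_self _ x]
  simp [mul_comm]

/-- The Riesz transform of the radial density is `bilapConst` times the field `2 E(|x|²) x`. -/
theorem rieszTransform_density {δ : ℝ} (hδ : 0 < δ) (hδ1 : δ ≤ 1) (x : E5) :
    rieszTransform 2 (volume.withDensityᵥ (density δ)) x =
      (bilapConst * (2 * profile δ (‖x‖ ^ 2))) • x := by
  ext i
  rw [rieszTransform_withDensityᵥ_apply (contDiff_density hδ) (hasCompactSupport_density hδ hδ1),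
    pot_pd_density hδ hδ1, PiLp.smul_apply, smul_eq_mul]
  ring

theorem thinShell_subset_shell {δ ε : ℝ} (hδ : 0 < δ) (h : δ ≤ ε) : thinShell δ ⊆ shell 5 ε := by
  rintro x ⟨h1, h2⟩
  constructor <;> nlinarith [norm_nonneg x]

/-- The field `∇ u` is of order `δ` on the shell carrying the density. -/
theorem norm_field_le {δ : ℝ} (hδ : 0 < δ) (hδ1 : δ ≤ 1) {x : E5} (hx : x ∈ thinShell δ) :
    bilapConst * (2 * |profile δ (‖x‖ ^ 2)|) * ‖x‖ ≤ 4 * bilapConst * δ := by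
  have hn : ‖x‖ ≤ 2 := by
    have := hx.2
    nlinarith [norm_nonneg x]
  have hp := abs_profile_le hx.1 hx.2
  have hc := bilapConst_pos
  calc bilapConst * (2 * |profile δ (‖x‖ ^ 2)|) * ‖x‖ ≤ bilapConst * (2 * δ) * 2 := by gcongr
    _ = 4 * bilapConst * δ := by ring

/-- A thickness for which the field is smaller than `ε` on the shell. -/
theorem exists_thickness {ε : ℝ} (hε : 0 < ε) :
    ∃ δ, 0 < δ ∧ δ ≤ 1 ∧ δ ≤ ε ∧ 4 * bilapConst * δ < ε := by
  have hc := bilapConst_pos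
  refine ⟨min (min 1 ε) (ε / (8 * bilapConst)), by positivity, ?_, ?_, ?_⟩
  · exact (min_le_left _ _).trans (min_le_left _ _)
  · exact (min_le_left _ _).trans (min_le_right _ _)
  · calc 4 * bilapConst * min (min 1 ε) (ε / (8 * bilapConst))
        ≤ 4 * bilapConst * (ε / (8 * bilapConst)) := by
          gcongr
          exact min_le_right _ _
      _ = ε / 2 := by
          field_simp
          norm_num
      _ < ε := by linarith

/-- The measure with density `Δ² u`, together with the compactness of its support. -/
theorem exists_radial_measure {ε : ℝ} (hε : 0 < ε) :
    ∃ ν : SignedMeasure (EuclideanSpace ℝ (Fin 5)),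
      HasRadialSmoothDensity ν ∧ signedSupport ν ⊆ shell 5 ε ∧ IsCompact (signedSupport ν) ∧
      (∀ x, RieszTransformExists 2 ν x) ∧
      (∀ x ∈ signedSupport ν, ‖rieszTransform 2 ν x‖ < ε) ∧
      (∀ x, ‖x‖ = 2 → bilapConst / 4 < ‖rieszTransform 2 ν x‖) := by
  obtain ⟨δ, hδ, hδ1, hδε, hsmall⟩ := exists_thickness hε
  have hρ := contDiff_density hδ
  have hc := hasCompactSupport_density hδ hδ1
  have hint := hρ.continuous.integrable_of_hasCompactSupport (μ := volume) hc
  have hK := isCompact_thinShell hδ1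
  have hsupp : signedSupport (volume.withDensityᵥ (density δ)) ⊆ thinShell δ :=
    signedSupport_withDensityᵥ_subset hint hK.isClosed fun x hx => density_eq_zero hδ hx
  have hC := bilapConst_pos
  have hnorm : ∀ x, ‖rieszTransform 2 (volume.withDensityᵥ (density δ)) x‖ =
      bilapConst * (2 * |profile δ (‖x‖ ^ 2)|) * ‖x‖ := fun x => by
    rw [rieszTransform_density hδ hδ1, norm_smul, norm_mul, norm_mul]
    simp [abs_of_pos hC]
  refine ⟨volume.withDensityᵥ (density δ),
    ⟨density δ, hρ, ⟨fun r => densityProfile δ (r ^ 2), fun _ => rfl⟩, hint, rfl⟩,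
    hsupp.trans (thinShell_subset_shell hδ hδε),
    hK.of_isClosed_subset Measure.isClosed_support hsupp,
    rieszTransformExists_withDensityᵥ hρ.continuous hc, fun x hx => ?_, fun x hx => ?_⟩
  · rw [hnorm]
    exact (norm_field_le hδ hδ1 (hsupp hx)).trans_lt hsmall
  · rw [hnorm, hx, show (2 : ℝ) ^ 2 = 4 by norm_num, profile_four hδ hδ1]
    norm_num
    linarith

/-- The measure with density `∂₀ Δ² u`, whose potential is a multiple of `∂₀ u`. -/
theorem exists_potential_measure {ε : ℝ} (hε : 0 < ε) :
    ∃ η : SignedMeasure (EuclideanSpace ℝ (Fin 5)),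
      HasSmoothDensity η ∧ signedSupport η ⊆ shell 5 ε ∧ IsCompact (signedSupport η) ∧
      (∀ x, InversePotentialExists η x) ∧
      (∀ x ∈ signedSupport η, |inversePotential η x| < ε) ∧
      bilapConst / 4 < |inversePotential η !₂[2, 0, 0, 0, 0]| := by
  obtain ⟨δ, hδ, hδ1, hδε, hsmall⟩ := exists_thickness hε
  have hρ := (contDiff_density hδ).pd 0
  have hc := (hasCompactSupport_density hδ hδ1).pd 0
  have hint := hρ.continuous.integrable_of_hasCompactSupport (μ := volume) hc
  have hK := isCompact_thinShell hδ1
  have hsupp : signedSupport (volume.withDensityᵥ (pd 0 (density δ))) ⊆ thinShell δ :=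
    signedSupport_withDensityᵥ_subset hint hK.isClosed fun x hx => pd_density_eq_zero hδ hδ1 0 hx
  have hC := bilapConst_pos
  have habs : ∀ x, |inversePotential (volume.withDensityᵥ (pd 0 (density δ))) x| =
      bilapConst * (2 * |profile δ (‖x‖ ^ 2)|) * |x 0| := fun x => by
    rw [inversePotential_withDensityᵥ hρ.continuous hc, pot_pd_density hδ hδ1, abs_mul, abs_mul,
      abs_mul, abs_of_pos hC, abs_of_pos (two_pos (α := ℝ))]
    ring
  refine ⟨volume.withDensityᵥ (pd 0 (density δ)), ⟨pd 0 (density δ), hρ, hint, rfl⟩,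
    hsupp.trans (thinShell_subset_shell hδ hδε),
    hK.of_isClosed_subset Measure.isClosed_support hsupp,
    inversePotentialExists_withDensityᵥ hρ.continuous hc, fun x hx => ?_, ?_⟩
  · rw [habs]
    refine lt_of_le_of_lt ?_ ((norm_field_le hδ hδ1 (hsupp hx)).trans_lt hsmall)
    gcongr
    exact PiLp.norm_apply_le x 0
  · have hn : ‖(!₂[2, 0, 0, 0, 0] : E5)‖ ^ 2 = 4 := by
      rw [← norm_sq_eq_sum]
      norm_num [Fin.sum_univ_succ]
    rw [habs, hn, profile_four hδ hδ1]
    norm_num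
    linarith

/-- A function that is small on a set and exceeds a fixed bound at one point violates every
maximum principle constant. -/
theorem const_mul_iSup_enorm_lt {G : Type*} [NormedAddCommGroup G] {f : E5 → G} {s : Set E5}
    {a ε : ℝ} {C : ℝ≥0} {p : E5} (hε : 0 ≤ ε) (hs : ∀ x ∈ s, ‖f x‖ < ε) (hp : a < ‖f p‖)
    (hC : C * ε ≤ a) : (C : ℝ≥0∞) * (⨆ x ∈ s, ‖f x‖ₑ) < ⨆ x, ‖f x‖ₑ := by
  have h1 : (⨆ x ∈ s, ‖f x‖ₑ) ≤ ENNReal.ofReal ε := iSup₂_le fun x hx => by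
    rw [← ofReal_norm]
    exact ENNReal.ofReal_le_ofReal (hs x hx).le
  calc (C : ℝ≥0∞) * (⨆ x ∈ s, ‖f x‖ₑ) ≤ C * ENNReal.ofReal ε := by gcongr
    _ = ENNReal.ofReal (C * ε) := by
        rw [ENNReal.ofReal_mul C.coe_nonneg, ENNReal.ofReal_coe_nnreal]
    _ ≤ ENNReal.ofReal a := ENNReal.ofReal_le_ofReal hC
    _ < ENNReal.ofReal ‖f p‖ := (ENNReal.ofReal_lt_ofReal_iff
        ((mul_nonneg C.coe_nonneg hε).trans hC |>.trans_lt hp)).2 hp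
    _ = ‖f p‖ₑ := ofReal_norm _
    _ ≤ ⨆ x, ‖f x‖ₑ := le_iSup (fun x => ‖f x‖ₑ) p

theorem const_mul_div_add_one_le {a : ℝ} (ha : 0 < a) (C : ℝ≥0) : C * (a / (C + 1)) ≤ a := by
  have : (0 : ℝ) < C + 1 := by positivity
  rw [mul_div_assoc', div_le_iff₀ this]
  nlinarith

theorem mainTheorem4 :
    -- the radial signed measures `ν(ε)` in `ℝ^5`
    (∃ a : ℝ, 0 < a ∧ ∀ ε : ℝ, 0 < ε →
      ∃ ν : SignedMeasure (EuclideanSpace ℝ (Fin 5)),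
        HasRadialSmoothDensity ν ∧
        signedSupport ν ⊆ shell 5 ε ∧
        (∀ x, RieszTransformExists 2 ν x) ∧
        (∀ x ∈ signedSupport ν, ‖rieszTransform 2 ν x‖ < ε) ∧
        (∀ x, ‖x‖ = 2 → a < ‖rieszTransform 2 ν x‖)) ∧
    -- the maximum principle fails for signed measures, even radial ones
    (∀ C : ℝ≥0, ∃ ν : SignedMeasure (EuclideanSpace ℝ (Fin 5)),
        HasRadialSmoothDensity ν ∧
        IsCompact (signedSupport ν) ∧
        (∀ x, RieszTransformExists 2 ν x) ∧
        (C : ℝ≥0∞) * (⨆ x ∈ signedSupport ν, ‖rieszTransform 2 ν x‖ₑ) <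
          ⨆ x, ‖rieszTransform 2 ν x‖ₑ) ∧
    -- the signed measures `η(ε)` for the potential with kernel `1 / |y - x|`
    (∃ b : ℝ, 0 < b ∧ ∀ ε : ℝ, 0 < ε →
      ∃ η : SignedMeasure (EuclideanSpace ℝ (Fin 5)),
        HasSmoothDensity η ∧
        signedSupport η ⊆ shell 5 ε ∧
        (∀ x, InversePotentialExists η x) ∧
        (∀ x ∈ signedSupport η, |inversePotential η x| < ε) ∧
        b < |inversePotential η !₂[2, 0, 0, 0, 0]|) ∧
    -- the analogous maximum principle fails for this potential
    (∀ C : ℝ≥0, ∃ η : SignedMeasure (EuclideanSpace ℝ (Fin 5)),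
        HasSmoothDensity η ∧
        IsCompact (signedSupport η) ∧
        (∀ x, InversePotentialExists η x) ∧
        (C : ℝ≥0∞) * (⨆ x ∈ signedSupport η, ‖inversePotential η x‖ₑ) <
          ⨆ x, ‖inversePotential η x‖ₑ) := by
  have ha : 0 < bilapConst / 4 := by
    have := bilapConst_pos
    positivity
  refine ⟨⟨bilapConst / 4, ha, fun ε hε => ?_⟩, fun C => ?_, ⟨bilapConst / 4, ha, fun ε hε => ?_⟩,
    fun C => ?_⟩
  · obtain ⟨ν, h1, h2, -, h4, h5, h6⟩ := exists_radial_measure hε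
    exact ⟨ν, h1, h2, h4, h5, h6⟩
  · have hε : 0 < bilapConst / 4 / (C + 1) := by positivity
    obtain ⟨ν, h1, -, h3, h4, h5, h6⟩ := exists_radial_measure hε
    exact ⟨ν, h1, h3, h4, const_mul_iSup_enorm_lt hε.le h5
      (h6 (EuclideanSpace.single 0 2) (by simp)) (const_mul_div_add_one_le ha C)⟩
  · obtain ⟨η, h1, h2, -, h4, h5, h6⟩ := exists_potential_measure hε
    exact ⟨η, h1, h2, h4, h5, h6⟩
  · have hε : 0 < bilapConst / 4 / (C + 1) := by positivity
    obtain ⟨η, h1, -, h3, h4, h5, h6⟩ := exists_potential_measure hε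
    exact ⟨η, h1, h3, h4, const_mul_iSup_enorm_lt hε.le h5 h6 (const_mul_div_add_one_le ha C)⟩
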